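/- Let $\lambda$ be Lebesgue measure on $[0,1]$ and let $\mathrm{Aut}([0,1],\lambda)$ be the group of $\lambda$-preserving Borel automorphisms of $[0,1]$, two of them being identified when they agree $\lambda$-almost everywhere, equipped with the weak topology, i.e. the coarsest topology for which $g\mapsto\lambda(gA\,\triangle\,B)$ is continuous for all Borel sets $A,B\subseteq[0,1]$. Call $f,g\in\mathrm{Aut}([0,1],\lambda)$ topologically similar if the cyclic subgroups $\langle f\rangle$ and $\langle g\rangle$, with the subspace topologies, are isomorphic as topological groups. Then for every $f\in\mathrm{Aut}([0,1],\lambda)$ the topological similarity class of $f$ is meagre in $\mathrm{Aut}([0,1],\lambda)$. Moreover, the conjugacy class of $f$ is contained in the topological similarity class of $f$, and hence is meagre too. -/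

import Mathlib

open MeasureTheory Topology

/-- Borel automorphisms of `[0,1]` (Borel bijections with Borel inverse) preserving Lebesgue
measure `λ`, as a group under composition: `(e₁ * e₂) x = e₁ (e₂ x)`. -/
structure BorelAut where
  /-- the underlying Borel isomorphism -/
  toEquiv : unitInterval ≃ᵐ unitInterval
  /-- it preserves Lebesgue measure -/
  pres : MeasurePreserving toEquiv volume volume

namespace BorelAut

theorem ext' {a b : BorelAut} (h : a.toEquiv = b.toEquiv) : a = b := by
  cases a; cases b; cases h; rfl

instance : One BorelAut := ⟨⟨MeasurableEquiv.refl _, MeasurePreserving.id _⟩⟩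

instance : Mul BorelAut := ⟨fun a b => ⟨b.toEquiv.trans a.toEquiv, a.pres.comp b.pres⟩⟩

instance : Inv BorelAut := ⟨fun a => ⟨a.toEquiv.symm, a.pres.symm⟩⟩

instance : Group BorelAut :=
  Group.ofLeftAxioms (fun _ _ _ => ext' rfl) (fun _ => ext' rfl)
    (fun a => ext' (MeasurableEquiv.ext (funext fun x => a.toEquiv.symm_apply_apply x)))

theorem mul_apply (a b : BorelAut) (x : unitInterval) :
    (a * b).toEquiv x = a.toEquiv (b.toEquiv x) := rfl

theorem one_apply (x : unitInterval) : (1 : BorelAut).toEquiv x = x := rfl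

theorem inv_mul_apply (a : BorelAut) (x : unitInterval) :
    (a⁻¹).toEquiv (a.toEquiv x) = x := a.toEquiv.symm_apply_apply x

theorem mul_inv_apply (a : BorelAut) (x : unitInterval) :
    a.toEquiv ((a⁻¹).toEquiv x) = x := a.toEquiv.apply_symm_apply x

/-- The automorphisms equal to the identity almost everywhere. -/
def nullSubgroup : Subgroup BorelAut where
  carrier := {a | ∀ᵐ x ∂(volume : Measure unitInterval), a.toEquiv x = x}
  one_mem' := by
    change ∀ᵐ x ∂(volume : Measure unitInterval), (1 : BorelAut).toEquiv x = x
    exact Filter.Eventually.of_forall one_apply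
  mul_mem' := by
    intro a b ha hb
    change ∀ᵐ x ∂(volume : Measure unitInterval), (a * b).toEquiv x = x
    change ∀ᵐ x ∂(volume : Measure unitInterval), a.toEquiv x = x at ha
    change ∀ᵐ x ∂(volume : Measure unitInterval), b.toEquiv x = x at hb
    filter_upwards [ha, hb] with x hxa hxb
    rw [mul_apply, hxb, hxa]
  inv_mem' := by
    intro a ha
    change ∀ᵐ x ∂(volume : Measure unitInterval), (a⁻¹).toEquiv x = x
    change ∀ᵐ x ∂(volume : Measure unitInterval), a.toEquiv x = x at ha
    filter_upwards [ha] with x hx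
    conv_lhs => rw [← hx]
    exact inv_mul_apply a x

instance : nullSubgroup.Normal where
  conj_mem := by
    intro n hn g
    have h := (g⁻¹).pres.quasiMeasurePreserving.ae hn
    change ∀ᵐ x ∂(volume : Measure unitInterval), (g * n * g⁻¹).toEquiv x = x
    filter_upwards [h] with x hx
    rw [mul_apply, mul_apply, hx, mul_inv_apply]

/-- `λ(gA ∆ B)`. -/
noncomputable def imageDist (A B : Set unitInterval) (g : BorelAut) : ℝ :=
  volume.real (symmDiff (g.toEquiv '' A) B)

/-- `λ(gA ∆ B)` only depends on `g` up to almost everywhere equality. -/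
theorem imageDist_congr (A B : Set unitInterval) {a b : BorelAut}
    (h : a⁻¹ * b ∈ nullSubgroup) : imageDist A B a = imageDist A B b := by
  have h1 : ∀ᵐ x ∂(volume : Measure unitInterval),
      (b⁻¹).toEquiv x = (a⁻¹).toEquiv x := by
    have h2 := (b⁻¹).pres.quasiMeasurePreserving.ae h
    filter_upwards [h2] with x hx
    rw [mul_apply, mul_inv_apply] at hx
    exact hx.symm
  have im : ∀ c : BorelAut, c.toEquiv '' A = (c⁻¹).toEquiv ⁻¹' A := fun c =>
    c.toEquiv.image_eq_preimage_symm A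
  unfold imageDist
  apply measureReal_congr
  filter_upwards [h1] with x hx
  apply propext
  change x ∈ symmDiff (a.toEquiv '' A) B ↔ x ∈ symmDiff (b.toEquiv '' A) B
  rw [im, im, Set.mem_symmDiff, Set.mem_symmDiff, Set.mem_preimage, Set.mem_preimage, hx]

end BorelAut

/-- The group `Aut([0,1],λ)` of Lebesgue measure preserving automorphisms of the unit interval,
two automorphisms being identified when they agree almost everywhere. -/
def AutLebesgue : Type := BorelAut ⧸ BorelAut.nullSubgroup

namespace AutLebesgue

instance : Group AutLebesgue := inferInstanceAs (Group (BorelAut ⧸ BorelAut.nullSubgroup))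

/-- The map `g ↦ λ(gA ∆ B)` on `Aut([0,1],λ)`. -/
noncomputable def imageDist (A B : Set unitInterval) (g : AutLebesgue) : ℝ :=
  Quotient.liftOn g (BorelAut.imageDist A B) fun _ _ h =>
    BorelAut.imageDist_congr A B (QuotientGroup.leftRel_apply.mp h)

/-- The weak topology: the coarsest topology making `g ↦ λ(gA ∆ B)` continuous for all Borel
sets `A` and `B`. -/
noncomputable instance : TopologicalSpace AutLebesgue :=
  ⨅ (A : {A : Set unitInterval // MeasurableSet A}) (B : {B : Set unitInterval // MeasurableSet B}),
    TopologicalSpace.induced (imageDist A B) inferInstance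

end AutLebesgue

/-- `f` and `g` are topologically similar if the subgroups `⟨f⟩` and `⟨g⟩`, with the subspace
topologies, are isomorphic as topological groups. -/
def TopologicallySimilar {G : Type*} [Group G] [TopologicalSpace G] (f g : G) : Prop :=
  Nonempty (Subgroup.zpowers f ≃ₜ* Subgroup.zpowers g)

/-! ### Measure estimates for Borel automorphisms. -/

namespace BorelAut

/-! The key property is that for every unbounded S ⊆ ℕ the elements killed by some s ∈ S are dense.
Given f ≠ 1, some neighbourhood V of 1 misses f^s for all s in an unbounded S. An isomorphism ⟨f⟩ ≅
⟨g⟩ sends f to some g^k, and continuity of its inverse keeps g^(ks) outside a basic neighbourhood W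
of 1 for all s ∈ S. For fixed k and W such g form a nowhere dense set, since g^s = 1 rules this out;
countably many k and W suffice (`isMeagre_setOf_topologicallySimilar`).

Density (`AutLebesgue.dense_setOf_exists_pow_eq_one`) comes from Birkhoff's theorem. Cut [0,1] into
N equal cells. The measures of cells intersected with g-preimages of cells, scaled by N, form a
doubly stochastic matrix, and the error on unions of cells is linear in it, so some permutation of
the cells does no worse than g (`exists_perm_sum_le`). Cutting each cell into s pieces imitates this
permutation by one of order dividing s, at an extra cost of at most 1/s
(`Equiv.Perm.exists_pow_eq_one_fst_eq`). As N does not depend on s, every large s works. -/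

theorem measurableSet_image (a : BorelAut) {A : Set unitInterval} (hA : MeasurableSet A) :
    MeasurableSet (a.toEquiv '' A) :=
  a.toEquiv.measurableSet_image.2 hA

theorem measureReal_image (a : BorelAut) (A : Set unitInterval) :
    volume.real (a.toEquiv '' A) = volume.real A := by
  rw [a.toEquiv.image_eq_preimage_symm, measureReal_def, measureReal_def,
    a.pres.symm.measure_preimage_equiv]

theorem image_mul (a b : BorelAut) (A : Set unitInterval) :
    (a * b).toEquiv '' A = a.toEquiv '' (b.toEquiv '' A) := by
  rw [Set.image_image]; rfl

theorem image_inv_image (a : BorelAut) (A : Set unitInterval) :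
    a.toEquiv '' ((a⁻¹).toEquiv '' A) = A := by
  rw [Set.image_image]
  simp only [mul_inv_apply, Set.image_id']

theorem imageDist_image (a : BorelAut) (A B : Set unitInterval) :
    volume.real (symmDiff (a.toEquiv '' A) (a.toEquiv '' B)) = volume.real (symmDiff A B) := by
  rw [← Set.image_symmDiff a.toEquiv.injective, measureReal_image]

theorem measureReal_symmDiff_triangle (A B C : Set unitInterval) :
    volume.real (symmDiff A C) ≤ volume.real (symmDiff A B) + volume.real (symmDiff B C) :=
  measureReal_symmDiff_le C

theorem imageDist_mul_le (a b : BorelAut) (A B C : Set unitInterval) :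
    imageDist A C (a * b) ≤ imageDist B C a + imageDist A B b := by
  have := measureReal_symmDiff_triangle (a.toEquiv '' (b.toEquiv '' A)) (a.toEquiv '' B) C
  rw [imageDist_image] at this
  rw [imageDist, imageDist, imageDist, image_mul]
  linarith

theorem imageDist_inv (a : BorelAut) (A B : Set unitInterval) :
    imageDist A B a⁻¹ = imageDist B A a := by
  rw [imageDist, ← imageDist_image a, image_inv_image, symmDiff_comm, imageDist]

theorem imageDist_one (A B : Set unitInterval) :
    imageDist A B 1 = volume.real (symmDiff A B) := by
  rw [imageDist, show (1 : BorelAut).toEquiv '' A = A from Set.image_id A]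

end BorelAut

/-! ### The weak topology: a T1, first countable group topology. -/

namespace AutLebesgue

/-- The class of a Borel automorphism modulo null sets. -/
def mk : BorelAut →* AutLebesgue := QuotientGroup.mk' BorelAut.nullSubgroup

theorem mk_surjective : Function.Surjective mk := QuotientGroup.mk'_surjective _

theorem mk_eq_one {a : BorelAut} : mk a = 1 ↔ a ∈ BorelAut.nullSubgroup :=
  QuotientGroup.eq_one_iff a

theorem imageDist_mk (A B : Set unitInterval) (a : BorelAut) :
    imageDist A B (mk a) = BorelAut.imageDist A B a := rfl

theorem imageDist_nonneg (A B : Set unitInterval) (g : AutLebesgue) : 0 ≤ imageDist A B g := by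
  obtain ⟨a, rfl⟩ := mk_surjective g
  exact measureReal_nonneg

theorem imageDist_mul_le (g h : AutLebesgue) (A B C : Set unitInterval) :
    imageDist A C (g * h) ≤ imageDist B C g + imageDist A B h := by
  obtain ⟨a, rfl⟩ := mk_surjective g
  obtain ⟨b, rfl⟩ := mk_surjective h
  rw [← map_mul]
  exact BorelAut.imageDist_mul_le a b A B C

theorem imageDist_inv (g : AutLebesgue) (A B : Set unitInterval) :
    imageDist A B g⁻¹ = imageDist B A g := by
  obtain ⟨a, rfl⟩ := mk_surjective g
  rw [← map_inv]
  exact BorelAut.imageDist_inv a A B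

theorem imageDist_one (A B : Set unitInterval) :
    imageDist A B 1 = volume.real (symmDiff A B) :=
  BorelAut.imageDist_one A B

theorem exists_imageDist_eq_zero (g : AutLebesgue) {A : Set unitInterval}
    (hA : MeasurableSet A) : ∃ B, MeasurableSet B ∧ imageDist A B g = 0 := by
  obtain ⟨a, rfl⟩ := mk_surjective g
  refine ⟨a.toEquiv '' A, a.measurableSet_image hA, ?_⟩
  simp [imageDist_mk, BorelAut.imageDist]

theorem imageDist_le_add (g h : AutLebesgue) (A B C : Set unitInterval) :
    imageDist A B g ≤ imageDist A B h + (imageDist A C g + imageDist A C h) := by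
  obtain ⟨a, rfl⟩ := mk_surjective g
  obtain ⟨b, rfl⟩ := mk_surjective h
  simp only [imageDist_mk, BorelAut.imageDist]
  have h1 := BorelAut.measureReal_symmDiff_triangle (a.toEquiv '' A) C B
  have h2 := BorelAut.measureReal_symmDiff_triangle C (b.toEquiv '' A) B
  rw [symmDiff_comm C (b.toEquiv '' A)] at h2
  linarith

theorem continuous_imageDist {A B : Set unitInterval} (hA : MeasurableSet A)
    (hB : MeasurableSet B) : Continuous (imageDist A B) := by
  rw [continuous_iff_le_induced]
  exact iInf_le_of_le (⟨A, hA⟩ : {A : Set unitInterval // MeasurableSet A})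
    (iInf_le_of_le (⟨B, hB⟩ : {B : Set unitInterval // MeasurableSet B}) le_rfl)

/-- Only pairs with B = gA modulo null sets need testing: for general B, replacing g by u changes
λ(gA ∆ B) by at most λ(uA ∆ gA). -/
theorem tendsto_nhds_of_imageDist {ι : Type*} {l : Filter ι} {u : ι → AutLebesgue}
    {g : AutLebesgue}
    (h : ∀ A B, MeasurableSet A → MeasurableSet B → imageDist A B g = 0 →
      Filter.Tendsto (fun i => imageDist A B (u i)) l (𝓝 0)) :
    Filter.Tendsto u l (𝓝 g) := by
  rw [nhds_iInf, Filter.tendsto_iInf]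
  rintro ⟨A, hA⟩
  rw [nhds_iInf, Filter.tendsto_iInf]
  rintro ⟨B, hB⟩
  rw [nhds_induced, Filter.tendsto_comap_iff]
  obtain ⟨C, hC, hgC⟩ := exists_imageDist_eq_zero g hA
  refine tendsto_iff_dist_tendsto_zero.2
    (squeeze_zero (fun _ => dist_nonneg) (fun i => ?_) (h A C hA hC hgC))
  rw [Function.comp_apply, Real.dist_eq, abs_sub_le_iff]
  have h1 := imageDist_le_add (u i) g A B C
  have h2 := imageDist_le_add g (u i) A B C
  constructor <;> linarith

theorem tendsto_imageDist {ι : Type*} {l : Filter ι} {u : ι → AutLebesgue}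
    {g : AutLebesgue} (hu : Filter.Tendsto u l (𝓝 g)) {A B : Set unitInterval}
    (hA : MeasurableSet A) (hB : MeasurableSet B) (h : imageDist A B g = 0) :
    Filter.Tendsto (fun i => imageDist A B (u i)) l (𝓝 0) :=
  h ▸ ((continuous_imageDist hA hB).tendsto g).comp hu

instance : IsTopologicalGroup AutLebesgue where
  continuous_mul := by
    refine continuous_iff_continuousAt.2 fun ⟨g, h⟩ =>
      tendsto_nhds_of_imageDist fun A C hA hC h0 => ?_
    obtain ⟨B, hB, hhB⟩ := exists_imageDist_eq_zero h hA
    have hgB : imageDist B C g = 0 := by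
      refine le_antisymm ?_ (imageDist_nonneg _ _ _)
      have := imageDist_mul_le (g * h) h⁻¹ B A C
      rw [mul_inv_cancel_right, imageDist_inv] at this
      linarith
    have h1 := tendsto_imageDist (continuous_fst.tendsto (g, h)) hB hC hgB
    have h2 := tendsto_imageDist (continuous_snd.tendsto (g, h)) hA hB hhB
    refine squeeze_zero (fun _ => imageDist_nonneg _ _ _) (fun p => ?_)
      (by simpa using h1.add h2)
    exact imageDist_mul_le _ _ _ _ _
  continuous_inv := by
    refine continuous_iff_continuousAt.2 fun g =>
      tendsto_nhds_of_imageDist fun A B hA hB h0 => ?_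
    simp only [imageDist_inv] at h0 ⊢
    exact tendsto_imageDist Filter.tendsto_id hB hA h0

/-- The Borel σ-algebra is countably separated, so a map whose preimages fix every Borel set modulo
null sets is almost everywhere the identity. -/
theorem eq_one_of_imageDist_eq_zero {g : AutLebesgue}
    (h : ∀ A, MeasurableSet A → imageDist A A g = 0) : g = 1 := by
  obtain ⟨a, rfl⟩ := mk_surjective g
  refine mk_eq_one.2 ?_
  have : (a.toEquiv : unitInterval → unitInterval) =ᵐ[volume] id := by
    refine Filter.EventuallyEq.of_forall_separating_preimage MeasurableSet fun U hU => ?_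
    have h1 := h U hU
    rw [← imageDist_inv, ← map_inv, imageDist_mk, BorelAut.imageDist,
      measureReal_eq_zero_iff, measure_symmDiff_eq_zero_iff] at h1
    rwa [MeasurableEquiv.image_eq_preimage_symm] at h1
  exact this

instance : T1Space AutLebesgue := by
  have h1 : IsClosed ({1} : Set AutLebesgue) := by
    have : ({1} : Set AutLebesgue) = ⋂ A : {A : Set unitInterval // MeasurableSet A},
        imageDist A.1 A.1 ⁻¹' {0} := by
      ext g
      simp only [Set.mem_singleton_iff, Set.mem_iInter, Set.mem_preimage]
      refine ⟨?_, fun h => eq_one_of_imageDist_eq_zero fun A hA => h ⟨A, hA⟩⟩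
      rintro rfl A
      simp [imageDist_one]
    rw [this]
    exact isClosed_iInter fun A => isClosed_singleton.preimage (continuous_imageDist A.2 A.2)
  exact IsTopologicalGroup.t1Space _ h1

/-- Serves to make 𝓝 1 countably generated, through a countable dense family. -/
theorem nhds_one_eq {𝒜 : Set (Set unitInterval)}
    (h𝒜 : (volume : Measure unitInterval).MeasureDense 𝒜) :
    𝓝 (1 : AutLebesgue) = ⨅ A : 𝒜, Filter.comap (imageDist A.1 A.1) (𝓝 0) := by
  refine le_antisymm (le_iInf fun A => ?_) ?_
  · have hA := h𝒜.measurable A A.2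
    exact Filter.tendsto_iff_comap.1
      (tendsto_imageDist (g := 1) Filter.tendsto_id hA hA (by simp [imageDist_one]))
  · refine tendsto_nhds_of_imageDist (u := id) fun B C hB hC h0 => ?_
    refine (tendsto_order.2 ⟨fun ε hε => .of_forall fun g => hε.trans_le
      (imageDist_nonneg _ _ _), fun ε hε => ?_⟩)
    -- One third for λ(gA ∆ A), and one for each of the two exchanges of B and A, before and after
    -- applying g.
    obtain ⟨A, hA, hAB⟩ := h𝒜.approx B hB (measure_ne_top _ _) (ε / 3) (by positivity)
    have hAB' : volume.real (symmDiff B A) < ε / 3 := by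
      rw [measureReal_def]
      exact (ENNReal.lt_ofReal_iff_toReal_lt (measure_ne_top _ _)).1 hAB
    have ht : Filter.Tendsto (imageDist A A)
        (⨅ A : 𝒜, Filter.comap (imageDist A.1 A.1) (𝓝 0)) (𝓝 0) :=
      Filter.tendsto_iff_comap.2 (iInf_le _ (⟨A, hA⟩ : 𝒜))
    filter_upwards [ht.eventually (gt_mem_nhds (show (0 : ℝ) < ε / 3 by positivity))] with g hg
    rw [imageDist_one] at h0
    have h1 := imageDist_mul_le g 1 B A A
    have h2 := imageDist_mul_le 1 g B A C
    rw [imageDist_one, mul_one] at h1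
    rw [imageDist_one, one_mul] at h2
    have h3 := BorelAut.measureReal_symmDiff_triangle A B C
    rw [symmDiff_comm A B] at h3
    change imageDist B C g < ε
    linarith

instance : (𝓝 (1 : AutLebesgue)).IsCountablyGenerated := by
  obtain ⟨𝒜, h, h𝒜⟩ := exists_countable_measureDense (volume : Measure unitInterval)
  rw [nhds_one_eq h𝒜]
  have := h.to_subtype
  infer_instance

end AutLebesgue

/-! ### Meagre similarity classes in abstract topological groups. -/

section TopologicalSimilarity

variable {G : Type*} [Group G] [TopologicalSpace G] [IsTopologicalGroup G]

theorem TopologicallySimilar.of_isConj {f g : G} (h : IsConj f g) : TopologicallySimilar f g := by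
  obtain ⟨c, rfl⟩ := isConj_iff.1 h
  have hm (x : Subgroup.zpowers f) : c * x * c⁻¹ ∈ Subgroup.zpowers (c * f * c⁻¹) := by
    obtain ⟨_, k, rfl⟩ := x
    exact ⟨k, conj_zpow⟩
  have hm' (x : Subgroup.zpowers (c * f * c⁻¹)) : c⁻¹ * x * c ∈ Subgroup.zpowers f := by
    obtain ⟨_, k, rfl⟩ := x
    exact ⟨k, by simp only [conj_zpow]; group⟩
  exact ⟨{
    toFun := fun x => ⟨c * x * c⁻¹, hm x⟩
    invFun := fun x => ⟨c⁻¹ * x * c, hm' x⟩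
    left_inv := fun x => Subtype.ext (by simp [mul_assoc])
    right_inv := fun x => Subtype.ext (by simp [mul_assoc])
    map_mul' := fun x y => Subtype.ext (by simp [mul_assoc])
    continuous_toFun := by fun_prop
    continuous_invFun := by fun_prop }⟩

/-- Take V with f ∉ V V⁻¹: two consecutive powers of f cannot both lie in V. -/
theorem exists_nhds_one_frequently_pow_notMem [T1Space G] {f : G} (hf : f ≠ 1) :
    ∃ V ∈ 𝓝 (1 : G), ∀ n : ℕ, ∃ m ∈ {m : ℕ | f ^ m ∉ V}, n ≤ m := by
  obtain ⟨V, hV, hVf⟩ := exists_nhds_split_inv (isOpen_compl_singleton.mem_nhds hf.symm)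
  refine ⟨V, hV, fun n => ?_⟩
  by_contra! h
  have h1 : ∀ m, n ≤ m → f ^ m ∈ V := fun m hm => by
    by_contra h2
    exact absurd (h m h2) hm.not_gt
  refine hVf _ (h1 (n + 1) n.le_succ) _ (h1 n le_rfl) ?_
  simp [pow_succ']

/-- If every unbounded set of exponents kills a dense set of elements, then open singletons can
only occur in the trivial group. -/
theorem not_isOpen_singleton_one_of_dense_pow_eq_one [T1Space G] [Nontrivial G]
    (hd : ∀ S : Set ℕ, (∀ n, ∃ s ∈ S, n ≤ s) → Dense {g : G | ∃ s ∈ S, g ^ s = 1}) :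
    ¬ IsOpen ({1} : Set G) := by
  intro ho
  obtain ⟨f, hf⟩ := exists_ne (1 : G)
  obtain ⟨V, hV, hS⟩ := exists_nhds_one_frequently_pow_notMem hf
  have := discreteTopology_of_isOpen_singleton_one ho
  -- In a discrete group a dense set contains f itself, so f^s = 1 ∈ V for some s ∈ S, against the
  -- choice of S.
  obtain ⟨g, rfl, s, hs, h1⟩ := (hd _ hS).inter_open_nonempty {f} (isOpen_discrete _) ⟨f, rfl⟩
  exact hs (h1 ▸ mem_of_mem_nhds hV)

theorem isNowhereDense_setOf_forall_pow_notMem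
    (hd : ∀ S : Set ℕ, (∀ n, ∃ s ∈ S, n ≤ s) → Dense {g : G | ∃ s ∈ S, g ^ s = 1})
    {S : Set ℕ} (hS : ∀ n, ∃ s ∈ S, n ≤ s) {W : Set G} (hW : W ∈ 𝓝 1) (k : ℤ) :
    IsNowhereDense {g : G | ∀ s ∈ S, (g ^ k) ^ s ∉ W} := by
  -- With W shrunk to its interior the set is closed, so it is enough that its complement is dense.
  have hc : IsClosed {g : G | ∀ s ∈ S, (g ^ k) ^ s ∉ interior W} := by
    simp only [Set.ofPred_forall]
    refine isClosed_iInter fun s => isClosed_iInter fun _ => ?_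
    exact isOpen_interior.isClosed_compl.preimage (by fun_prop : Continuous fun g : G => (g ^ k) ^ s)
  have hn : IsNowhereDense {g : G | ∀ s ∈ S, (g ^ k) ^ s ∉ interior W} := by
    rw [hc.isNowhereDense_iff, interior_eq_empty_iff_dense_compl]
    refine (hd S hS).mono ?_
    rintro g ⟨s, hs, hg⟩ h
    refine h s hs ?_
    rw [← zpow_natCast, zpow_comm, zpow_natCast, hg, one_zpow]
    exact mem_interior_iff_mem_nhds.2 hW
  exact hn.mono fun g hg s hs h => hg s hs (interior_subset h)

theorem isMeagre_setOf_topologicallySimilar [T1Space G] [Nontrivial G]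
    [(𝓝 (1 : G)).IsCountablyGenerated]
    (hd : ∀ S : Set ℕ, (∀ n, ∃ s ∈ S, n ≤ s) → Dense {g : G | ∃ s ∈ S, g ^ s = 1}) (f : G) :
    IsMeagre {g : G | TopologicallySimilar f g} := by
  rcases eq_or_ne f 1 with rfl | hf
  · have h1 : IsNowhereDense ({1} : Set G) := by
      rw [isClosed_singleton.isNowhereDense_iff, ← Set.not_nonempty_iff_eq_empty]
      intro hne
      refine not_isOpen_singleton_one_of_dense_pow_eq_one hd ?_
      rw [← interior_eq_iff_isOpen]
      exact hne.subset_singleton_iff.1 interior_subset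
    refine h1.isMeagre.mono ?_
    rintro g ⟨φ⟩
    obtain ⟨⟨_, k, rfl⟩, hx⟩ := φ.surjective ⟨g, Subgroup.mem_zpowers g⟩
    have h2 : (⟨(1 : G) ^ k, k, rfl⟩ : Subgroup.zpowers (1 : G)) = 1 := Subtype.ext (one_zpow k)
    have h3 := hx.symm.trans ((congrArg φ h2).trans (map_one φ))
    exact congrArg Subtype.val h3
  · obtain ⟨V, hV, hS⟩ := exists_nhds_one_frequently_pow_notMem hf
    obtain ⟨W, hW⟩ := (𝓝 (1 : G)).exists_antitone_basis
    refine (isMeagre_iUnion fun n : ℕ => isMeagre_iUnion fun k : ℤ =>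
      (isNowhereDense_setOf_forall_pow_notMem hd hS (hW.1.mem_of_mem (i := n) trivial)
        k).isMeagre).mono ?_
    rintro g ⟨φ⟩
    obtain ⟨k, hk⟩ := (φ ⟨f, Subgroup.mem_zpowers f⟩).2
    have hc : Filter.Tendsto (fun x : Subgroup.zpowers g => (φ.symm x : G)) (𝓝 1) (𝓝 1) := by
      have : Continuous fun x : Subgroup.zpowers g => (φ.symm x : G) :=
        continuous_subtype_val.comp φ.symm.continuous
      simpa using this.tendsto 1
    -- Pull V back along the inverse isomorphism: powers of g close to 1 correspond to powers of f
    -- in V.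
    have hV' := hc hV
    rw [Filter.mem_map, nhds_subtype, Filter.mem_comap] at hV'
    obtain ⟨U, hU, hUV⟩ := hV'
    obtain ⟨n, -, hn⟩ := hW.1.mem_iff.1 hU
    refine Set.mem_iUnion.2 ⟨n, Set.mem_iUnion.2 ⟨k, fun s hs hgs => hs ?_⟩⟩
    have h1 : φ ⟨f, Subgroup.mem_zpowers f⟩ ^ s ∈
        ((↑) : Subgroup.zpowers g → G) ⁻¹' U := by
      refine hn ?_
      simpa [← hk] using hgs
    have h2 := hUV h1
    simpa using h2

end TopologicalSimilarity

/-- The reflection x ↦ 1 - x fixes only 1/2. -/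
instance : Nontrivial AutLebesgue := by
  refine ⟨AutLebesgue.mk ⟨unitInterval.symmMeasurableEquiv, unitInterval.measurePreserving_symm⟩,
    1, fun h => ?_⟩
  have h1 := AutLebesgue.mk_eq_one.1 h
  change ∀ᵐ x ∂(volume : Measure unitInterval), unitInterval.symm x = x at h1
  have h2 : ∀ᵐ x ∂(volume : Measure unitInterval), x = ⟨1 / 2, by norm_num, by norm_num⟩ := by
    filter_upwards [h1] with x hx
    have := congrArg Subtype.val hx
    rw [unitInterval.coe_symm_eq] at this
    exact Subtype.ext (by simp only; linarith)
  have h3 : ∀ᵐ x ∂(volume : Measure unitInterval), x ≠ ⟨1 / 2, by norm_num, by norm_num⟩ :=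
    Measure.ae_ne volume _
  obtain ⟨x, hx, hx'⟩ := (h2.and h3).exists
  exact hx' hx

/-! ### Equal subdivisions of [0,1] and permutations of their cells. -/

namespace BorelAut

/-- The `k`-th interval in the subdivision of `[0,1]` into intervals of length `1 / N`. -/
def cell (N k : ℕ) : Set unitInterval := {x | ⌊(N : ℝ) * x⌋₊ = k}

theorem measurable_floor_mul (N : ℕ) :
    Measurable fun x : unitInterval => ⌊(N : ℝ) * x⌋₊ :=
  Nat.measurable_floor.comp (measurable_subtype_coe.const_mul _)

theorem measurableSet_cell (N k : ℕ) : MeasurableSet (cell N k) :=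
  measurable_floor_mul N (measurableSet_singleton k)

theorem floor_mul_lt {N : ℕ} [NeZero N] {x : unitInterval} (hx : x ≠ 1) :
    ⌊(N : ℝ) * x⌋₊ < N := by
  have h0 : (0 : ℝ) < N := Nat.cast_pos.2 (NeZero.pos N)
  have h1 : (x : ℝ) < 1 := lt_of_le_of_ne x.2.2 fun h => hx (Subtype.ext h)
  rw [Nat.floor_lt (by have := x.2.1; positivity)]
  nlinarith

theorem measure_eq_sum_cell (N : ℕ) [NeZero N] (D : Set unitInterval) :
    volume D = ∑ k : Fin N, volume (D ∩ cell N k) := by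
  have h1 := sum_measure_preimage_singleton (μ := volume.restrict D) (Finset.range N)
    (f := fun x : unitInterval => ⌊(N : ℝ) * x⌋₊) fun k _ => measurableSet_cell N k
  have h2 : (volume.restrict D) ((fun x : unitInterval => ⌊(N : ℝ) * x⌋₊) ⁻¹'
      (Finset.range N : Set ℕ)) = volume.restrict D Set.univ := by
    refine measure_congr (ae_restrict_of_ae ?_)
    -- The point 1 is the only one outside the cells of index below N; its index is N.
    filter_upwards [Measure.ae_ne volume (1 : unitInterval)] with x hx
    exact propext ⟨fun _ => trivial, fun _ => Finset.mem_coe.2 (Finset.mem_range.2 (floor_mul_lt hx))⟩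
  rw [h2, Measure.restrict_apply_univ] at h1
  rw [← h1, ← Fin.sum_univ_eq_sum_range
    fun k => volume.restrict D ((fun x : unitInterval => ⌊(N : ℝ) * x⌋₊) ⁻¹' {k})]
  refine Finset.sum_congr rfl fun k _ => ?_
  rw [Set.inter_comm]
  exact Measure.restrict_apply (measurableSet_cell N k)

theorem measureReal_eq_sum_cell (N : ℕ) [NeZero N] (D : Set unitInterval) :
    volume.real D = ∑ k : Fin N, volume.real (D ∩ cell N k) := by
  simp only [measureReal_def]
  rw [measure_eq_sum_cell N D, ENNReal.toReal_sum fun _ _ => measure_ne_top _ _]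

theorem measureReal_cell {N : ℕ} (k : Fin N) : volume.real (cell N k) = (N : ℝ)⁻¹ := by
  have h0 : (0 : ℝ) < N := Nat.cast_pos.2 k.pos
  have hk : (k : ℝ) + 1 ≤ N := by exact_mod_cast k.2
  have : Subtype.val '' cell N k = Set.Ico ((k : ℝ) / N) (((k : ℝ) + 1) / N) := by
    ext y
    simp only [Set.mem_image, Set.mem_Ico, div_le_iff₀ h0, lt_div_iff₀ h0]
    constructor
    · rintro ⟨x, hx, rfl⟩
      have h1 : (0 : ℝ) ≤ N * x := mul_nonneg h0.le x.2.1
      have := (Nat.floor_eq_iff h1).1 hx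
      rwa [mul_comm (x : ℝ)]
    · rintro ⟨h1, h2⟩
      have hk0 : (0 : ℝ) ≤ k := Nat.cast_nonneg _
      have hy0 : 0 ≤ y := by
        by_contra! h
        nlinarith
      refine ⟨⟨y, hy0, by by_contra! h; nlinarith⟩, ?_, rfl⟩
      rw [mul_comm] at h1 h2
      exact (Nat.floor_eq_iff (mul_nonneg h0.le hy0)).2 ⟨h1, h2⟩
  rw [measureReal_def, unitInterval.volume_apply, this, Real.volume_Ico, ENNReal.toReal_ofReal]
  · field_simp; ring
  · field_simp; linarith

/-- Extension of a permutation of `Fin N` to `ℕ`. -/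
abbrev extendNat {N : ℕ} (e : Equiv.Perm (Fin N)) : Equiv.Perm ℕ :=
  e.extendDomain Fin.equivSubtype

theorem extendNat_val {N : ℕ} (e : Equiv.Perm (Fin N)) (k : Fin N) : extendNat e k = e k :=
  Equiv.Perm.extendDomain_apply_image e Fin.equivSubtype k

theorem extendNat_of_le {N : ℕ} (e : Equiv.Perm (Fin N)) {k : ℕ} (h : N ≤ k) :
    extendNat e k = k :=
  Equiv.Perm.extendDomain_apply_not_subtype e Fin.equivSubtype h.not_gt

/-- The map of `[0,1]` permuting the intervals of length `1 / N` by translations. -/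
noncomputable def cellMap {N : ℕ} [NeZero N] (e : Equiv.Perm (Fin N)) (x : unitInterval) :
    unitInterval :=
  ⟨(extendNat e ⌊(N : ℝ) * x⌋₊ + (N * x - ⌊(N : ℝ) * x⌋₊)) / N, by
    have h0 : (0 : ℝ) < N := Nat.cast_pos.2 (NeZero.pos N)
    have h1 : (0 : ℝ) ≤ N * x := mul_nonneg h0.le x.2.1
    have h2 := Nat.floor_le h1
    have h3 := Nat.lt_floor_add_one ((N : ℝ) * x)
    have h4 : (0 : ℝ) ≤ extendNat e ⌊(N : ℝ) * x⌋₊ := Nat.cast_nonneg _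
    refine ⟨div_nonneg (by linarith) h0.le, (div_le_one h0).2 ?_⟩
    rcases lt_or_ge ⌊(N : ℝ) * x⌋₊ N with h | h
    · have h5 : extendNat e ⌊(N : ℝ) * x⌋₊ + 1 ≤ N := by
        have := extendNat_val e ⟨_, h⟩
        simp only at this
        rw [this]
        exact (e ⟨_, h⟩).2
      have h6 : (extendNat e ⌊(N : ℝ) * x⌋₊ : ℝ) + 1 ≤ N := by exact_mod_cast h5
      linarith
    -- Only x = 1 occurs here. Fixing it makes the cell map bijective everywhere, not just almost
    -- everywhere.
    · rw [extendNat_of_le e h]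
      have := x.2.2
      nlinarith⟩

theorem mul_cellMap {N : ℕ} [NeZero N] (e : Equiv.Perm (Fin N)) (x : unitInterval) :
    (N : ℝ) * cellMap e x = extendNat e ⌊(N : ℝ) * x⌋₊ + (N * x - ⌊(N : ℝ) * x⌋₊) := by
  have h0 : (N : ℝ) ≠ 0 := Nat.cast_ne_zero.2 (NeZero.ne N)
  exact mul_div_cancel₀ _ h0

theorem floor_mul_cellMap {N : ℕ} [NeZero N] (e : Equiv.Perm (Fin N)) (x : unitInterval) :
    ⌊(N : ℝ) * cellMap e x⌋₊ = extendNat e ⌊(N : ℝ) * x⌋₊ := by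
  have h1 : (0 : ℝ) ≤ N * x := mul_nonneg (Nat.cast_nonneg _) x.2.1
  have h2 : (0 : ℝ) ≤ N * cellMap e x := mul_nonneg (Nat.cast_nonneg _) (cellMap e x).2.1
  rw [Nat.floor_eq_iff h2, mul_cellMap]
  have h3 := Nat.floor_le h1
  have h4 := Nat.lt_floor_add_one ((N : ℝ) * x)
  constructor <;> linarith

theorem cellMap_mul {N : ℕ} [NeZero N] (e e' : Equiv.Perm (Fin N)) (x : unitInterval) :
    cellMap (e * e') x = cellMap e (cellMap e' x) := by
  have h0 : (N : ℝ) ≠ 0 := Nat.cast_ne_zero.2 (NeZero.ne N)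
  refine Subtype.ext (mul_left_cancel₀ h0 ?_)
  have : extendNat (e * e') = extendNat e * extendNat e' :=
    (Equiv.Perm.extendDomain_mul Fin.equivSubtype e e').symm
  rw [mul_cellMap, mul_cellMap, floor_mul_cellMap, mul_cellMap, this, Equiv.Perm.mul_apply]
  ring

theorem cellMap_one {N : ℕ} [NeZero N] (x : unitInterval) :
    cellMap (1 : Equiv.Perm (Fin N)) x = x := by
  have h0 : (N : ℝ) ≠ 0 := Nat.cast_ne_zero.2 (NeZero.ne N)
  refine Subtype.ext (mul_left_cancel₀ h0 ?_)
  have : extendNat (1 : Equiv.Perm (Fin N)) = 1 := Equiv.Perm.extendDomain_one Fin.equivSubtype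
  rw [mul_cellMap, this, Equiv.Perm.one_apply]
  ring

theorem measurable_cellMap {N : ℕ} [NeZero N] (e : Equiv.Perm (Fin N)) :
    Measurable (cellMap e) := by
  have h1 : Measurable fun x : unitInterval => (⌊(N : ℝ) * x⌋₊ : ℝ) :=
    measurable_from_top.comp (measurable_floor_mul N)
  have h2 : Measurable fun x : unitInterval => (extendNat e ⌊(N : ℝ) * x⌋₊ : ℝ) :=
    (measurable_from_top (f := fun k : ℕ => (extendNat e k : ℝ))).comp (measurable_floor_mul N)
  refine Measurable.subtype_mk ?_
  exact (h2.add ((measurable_subtype_coe.const_mul _).sub h1)).div_const _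

/-- On the k-th cell the map is translation by (e k - k) / N, and Lebesgue measure on ℝ is
translation invariant. -/
theorem volume_cellMap_preimage_inter {N : ℕ} [NeZero N] (e : Equiv.Perm (Fin N)) (k : Fin N)
    (B : Set unitInterval) :
    volume (cellMap e ⁻¹' B ∩ cell N k) = volume (B ∩ cell N (e k)) := by
  have h0 : (N : ℝ) ≠ 0 := Nat.cast_ne_zero.2 (NeZero.ne N)
  rw [unitInterval.volume_apply, unitInterval.volume_apply,
    ← measure_preimage_add_right volume (((e k : ℕ) - (k : ℕ) : ℝ) / N)
      (Subtype.val '' (B ∩ cell N (e k)))]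
  congr 1
  ext y
  simp only [Set.mem_image, Set.mem_preimage]
  constructor
  · rintro ⟨x, ⟨hxB, hxk⟩, rfl⟩
    have hxk : ⌊(N : ℝ) * x⌋₊ = k := hxk
    refine ⟨cellMap e x, ⟨hxB, ?_⟩, ?_⟩
    · change ⌊(N : ℝ) * cellMap e x⌋₊ = _
      rw [floor_mul_cellMap, hxk, extendNat_val]
    · refine mul_left_cancel₀ h0 ?_
      rw [mul_cellMap, hxk, extendNat_val]
      field_simp
      ring
  · rintro ⟨z, ⟨hzB, hzk⟩, hzy⟩
    have hzk : ⌊(N : ℝ) * z⌋₊ = e k := hzk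
    have hk : extendNat e⁻¹ (e k) = k := by rw [extendNat_val, ← Equiv.Perm.mul_apply, inv_mul_cancel,
      Equiv.Perm.one_apply]
    refine ⟨cellMap e⁻¹ z, ⟨?_, ?_⟩, ?_⟩
    · rwa [Set.mem_preimage, ← cellMap_mul, mul_inv_cancel, cellMap_one]
    · change ⌊(N : ℝ) * cellMap e⁻¹ z⌋₊ = _
      rw [floor_mul_cellMap, hzk, hk]
    · refine mul_left_cancel₀ h0 ?_
      rw [mul_cellMap, hzk, hk, hzy]
      field_simp
      ring

theorem measurePreserving_cellMap {N : ℕ} [NeZero N] (e : Equiv.Perm (Fin N)) :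
    MeasurePreserving (cellMap e) volume volume := by
  refine ⟨measurable_cellMap e, Measure.ext fun B hB => ?_⟩
  rw [Measure.map_apply (measurable_cellMap e) hB, measure_eq_sum_cell N, measure_eq_sum_cell N B]
  simp only [volume_cellMap_preimage_inter]
  exact Equiv.sum_comp e fun k => volume (B ∩ cell N k)

/-- Permutations of the intervals of length `1 / N`, as Borel automorphisms. -/
noncomputable def cellPerm (N : ℕ) [NeZero N] : Equiv.Perm (Fin N) →* BorelAut where
  toFun e :=
    { toEquiv :=
        { toFun := cellMap e
          invFun := cellMap e⁻¹
          left_inv := fun x => by rw [← cellMap_mul, inv_mul_cancel, cellMap_one]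
          right_inv := fun x => by rw [← cellMap_mul, mul_inv_cancel, cellMap_one]
          measurable_toFun := measurable_cellMap e
          measurable_invFun := measurable_cellMap e⁻¹ }
      pres := measurePreserving_cellMap e }
  map_one' := ext' (MeasurableEquiv.ext (funext cellMap_one))
  map_mul' e e' := ext' (MeasurableEquiv.ext (funext (cellMap_mul e e')))

theorem cellPerm_apply {N : ℕ} [NeZero N] (e : Equiv.Perm (Fin N)) (x : unitInterval) :
    (cellPerm N e).toEquiv x = cellMap e x := rfl

/-- The union of the intervals of length `1 / N` whose index belongs to `𝒜`. -/
def cellUnion (N : ℕ) (𝒜 : Set ℕ) : Set unitInterval := {x | ⌊(N : ℝ) * x⌋₊ ∈ 𝒜}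

/-- Squeeze A between a compact K and an open U. Once 1 / N < δ, every cell meeting K lies in U, and
the union of these cells works. -/
theorem eventually_exists_cellUnion {A : Set unitInterval} (hA : MeasurableSet A) {ε : ℝ}
    (hε : 0 < ε) :
    ∀ᶠ N : ℕ in Filter.atTop, ∃ 𝒜, volume.real (symmDiff A (cellUnion N 𝒜)) < ε := by
  have hε2 : ENNReal.ofReal (ε / 2) ≠ 0 := by simpa using hε
  obtain ⟨K, hKA, hK, hAK⟩ :=
    hA.exists_isCompact_sdiff_lt (μ := volume) (measure_ne_top _ _) hε2
  obtain ⟨U, hAU, hU, -, hUA⟩ := hA.exists_isOpen_sdiff_lt (μ := volume) (measure_ne_top _ _) hε2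
  obtain ⟨δ, hδ, hKU⟩ := hK.exists_thickening_subset_open hU (hKA.trans hAU)
  obtain ⟨N₀, hN₀⟩ := exists_nat_one_div_lt hδ
  filter_upwards [Filter.eventually_ge_atTop (N₀ + 1)] with N hN
  have hN' : (N₀ : ℝ) + 1 ≤ N := by exact_mod_cast hN
  have hNpos : (0 : ℝ) < N := by linarith [(Nat.cast_nonneg N₀ : (0 : ℝ) ≤ N₀)]
  have hNδ : 1 < δ * N := by
    rw [div_lt_iff₀ (by positivity)] at hN₀
    nlinarith
  refine ⟨(fun x : unitInterval => ⌊(N : ℝ) * x⌋₊) '' K, ?_⟩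
  have hsub : symmDiff A (cellUnion N ((fun x : unitInterval => ⌊(N : ℝ) * x⌋₊) '' K)) ⊆
      (A \ K) ∪ (U \ A) := by
    rintro x (⟨hxA, hx⟩ | ⟨⟨y, hy, hxy⟩, hxA⟩)
    · exact Or.inl ⟨hxA, fun hxK => hx ⟨x, hxK, rfl⟩⟩
    · refine Or.inr ⟨hKU (Metric.mem_thickening_iff.2 ⟨y, hy, ?_⟩), hxA⟩
      have hxy : ⌊(N : ℝ) * y⌋₊ = ⌊(N : ℝ) * x⌋₊ := hxy
      have h1 := Nat.floor_le (mul_nonneg hNpos.le x.2.1)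
      have h2 := Nat.floor_le (mul_nonneg hNpos.le y.2.1)
      have h3 := Nat.lt_floor_add_one ((N : ℝ) * x)
      have h4 := Nat.lt_floor_add_one ((N : ℝ) * y)
      rw [hxy] at h2 h4
      rw [Subtype.dist_eq, Real.dist_eq, abs_sub_lt_iff]
      constructor <;> nlinarith
  have h1 : volume.real (A \ K) < ε / 2 :=
    (ENNReal.lt_ofReal_iff_toReal_lt (measure_ne_top _ _)).1 hAK
  have h2 : volume.real (U \ A) < ε / 2 :=
    (ENNReal.lt_ofReal_iff_toReal_lt (measure_ne_top _ _)).1 hUA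
  have h3 := measureReal_mono (μ := volume) hsub
  have h4 := measureReal_union_le (μ := volume) (A \ K) (U \ A)
  linarith

end BorelAut

/-! ### Birkhoff's theorem and periodic imitation of permutations. -/

/-- A linear functional attains its minimum over doubly stochastic matrices at a permutation. -/
theorem exists_perm_sum_le {n : Type*} [Fintype n] [DecidableEq n] {M : Matrix n n ℝ}
    (hM : M ∈ doublyStochastic ℝ n) (c : n → n → ℝ) :
    ∃ σ : Equiv.Perm n, ∑ i, c i (σ i) ≤ ∑ i, ∑ j, M i j * c i j := by
  obtain ⟨w, hw0, hw1, rfl⟩ := exists_eq_sum_perm_of_mem_doublyStochastic hM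
  have key : ∑ i, ∑ j, (∑ σ, w σ • σ.permMatrix ℝ) i j * c i j = ∑ σ, w σ * ∑ i, c i (σ i) := by
    simp only [Matrix.sum_apply, Matrix.smul_apply, Finset.sum_mul, Finset.mul_sum]
    rw [Finset.sum_congr rfl fun i _ => Finset.sum_comm, Finset.sum_comm]
    refine Finset.sum_congr rfl fun σ _ => ?_
    refine Finset.sum_congr rfl fun i _ => ?_
    rw [Finset.sum_eq_single (σ i)]
    · simp [PEquiv.toMatrix_apply]
    · intro j _ hj
      simp [PEquiv.toMatrix_apply, hj.symm]
    · simp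
  by_contra! h
  rw [key] at h
  -- If every permutation cost strictly more than the convex combination, so would their weighted
  -- average, which is that combination.
  have h1 : ∑ σ, w σ * ∑ τ, w τ * ∑ i, c i (τ i) < ∑ σ, w σ * ∑ i, c i (σ i) := by
    obtain ⟨σ, -, hσ⟩ : ∃ σ ∈ Finset.univ, (0 : ℝ) < w σ := by
      by_contra! h2
      have := Finset.sum_nonpos h2
      linarith
    exact Finset.sum_lt_sum (fun σ _ => mul_le_mul_of_nonneg_left (h σ).le (hw0 σ))
      ⟨σ, Finset.mem_univ σ, mul_lt_mul_of_pos_left (h σ) hσ⟩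
  rw [← Finset.sum_mul, hw1, one_mul] at h1
  exact lt_irrefl _ h1

/-- Any permutation is imitated, on a proportion `n / (n + 1)` of `n + 1` copies of its domain,
by a permutation of order dividing `n + 1`. -/
theorem Equiv.Perm.exists_pow_eq_one_fst_eq {α : Type*} (σ : Equiv.Perm α) (n : ℕ) :
    ∃ e : Equiv.Perm (α × Fin (n + 1)), e ^ (n + 1) = 1 ∧
      ∀ i t, t ≠ Fin.last n → (e (i, t)).1 = σ i := by
  -- Conjugating the cyclic shift `c` of the copies by `τ`, which acts as σ^t on copy t, gives (i,
  -- t) ↦ (σ^(t+1) σ^(-t) i, t + 1), except on the last copy, where the index wraps around.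
  let c : Equiv.Perm (α × Fin (n + 1)) := Equiv.prodCongr (Equiv.refl α) (Equiv.addRight 1)
  let τ : Equiv.Perm (α × Fin (n + 1)) := Equiv.prodCongrLeft fun t => σ ^ (t : ℕ)
  have hc (k : ℕ) (i : α) (t : Fin (n + 1)) : (c ^ k) (i, t) = (i, t + k • 1) := by
    induction k with
    | zero => simp
    | succ k ih =>
      rw [pow_succ', Equiv.Perm.mul_apply, ih, succ_nsmul, ← add_assoc]
      rfl
  refine ⟨τ * c * τ⁻¹, ?_, fun i t ht => ?_⟩
  · have : c ^ (n + 1) = 1 := by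
      ext1 ⟨i, t⟩
      have h1 : (n + 1) • (1 : Fin (n + 1)) = 0 := by
        simpa using card_nsmul_eq_zero (x := (1 : Fin (n + 1)))
      rw [hc, h1, add_zero, Equiv.Perm.one_apply]
    rw [conj_pow, this, mul_one, mul_inv_cancel]
  · have h1 : τ⁻¹ (i, t) = ((σ ^ (t : ℕ))⁻¹ i, t) := by
      rw [Equiv.Perm.inv_eq_iff_eq]
      simp [τ, Equiv.prodCongrLeft]
    have h2 : ((t + 1 : Fin (n + 1)) : ℕ) = t + 1 :=
      Fin.val_add_one_of_lt (Fin.lt_last_iff_ne_last.2 ht)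
    rw [Equiv.Perm.mul_apply, Equiv.Perm.mul_apply, h1]
    simp [c, τ, Equiv.prodCongrLeft, h2, pow_succ']

/-! ### Approximation by periodic permutations of cells. -/

namespace BorelAut

open Classical in
/-- The indicator of the pairs of indices on which membership in `𝒜` and `ℬ` disagree. -/
noncomputable def mismatch (𝒜 ℬ : Set ℕ) (i j : ℕ) : ℝ := if i ∈ 𝒜 ↔ j ∈ ℬ then 0 else 1

theorem mismatch_nonneg (𝒜 ℬ : Set ℕ) (i j : ℕ) : 0 ≤ mismatch 𝒜 ℬ i j := by
  rw [mismatch]; split_ifs <;> norm_num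

theorem mismatch_le_one (𝒜 ℬ : Set ℕ) (i j : ℕ) : mismatch 𝒜 ℬ i j ≤ 1 := by
  rw [mismatch]; split_ifs <;> norm_num

theorem mismatch_setOf (f : ℕ → ℕ) (𝒜 ℬ : Set ℕ) (i j : ℕ) :
    mismatch {k | f k ∈ 𝒜} {k | f k ∈ ℬ} i j = mismatch 𝒜 ℬ (f i) (f j) := by
  by_cases h : f i ∈ 𝒜 ↔ f j ∈ ℬ
  · rw [mismatch, mismatch, if_pos h]
    exact if_pos h
  · rw [mismatch, mismatch, if_neg h]
    exact if_neg h

theorem measureReal_preimage (a : BorelAut) (A : Set unitInterval) :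
    volume.real (a.toEquiv ⁻¹' A) = volume.real A := by
  rw [measureReal_def, measureReal_def, a.pres.measure_preimage_equiv]

theorem imageDist_eq_preimage (a : BorelAut) (A B : Set unitInterval) :
    imageDist A B a = volume.real (symmDiff A (a.toEquiv ⁻¹' B)) := by
  rw [imageDist, ← measureReal_preimage a, Set.preimage_symmDiff,
    Set.preimage_image_eq _ a.toEquiv.injective]

theorem measureReal_eq_sum_inter_preimage_cell (a : BorelAut) (N : ℕ) [NeZero N]
    (D : Set unitInterval) :
    volume.real D = ∑ j : Fin N, volume.real (D ∩ a.toEquiv ⁻¹' cell N j) := by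
  rw [← measureReal_image a, measureReal_eq_sum_cell N]
  refine Finset.sum_congr rfl fun j _ => ?_
  rw [← measureReal_preimage a, Set.preimage_inter, Set.preimage_image_eq _ a.toEquiv.injective]

/-- Each piece, cell i met with the preimage of cell j, lies wholly inside or outside the symmetric
difference. The error is thus linear in the overlap matrix, as Birkhoff's theorem requires. -/
theorem imageDist_cellUnion (a : BorelAut) (N : ℕ) [NeZero N] (𝒜 ℬ : Set ℕ) :
    imageDist (cellUnion N 𝒜) (cellUnion N ℬ) a =
      ∑ i : Fin N, ∑ j : Fin N,
        volume.real (cell N i ∩ a.toEquiv ⁻¹' cell N j) * mismatch 𝒜 ℬ i j := by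
  rw [imageDist_eq_preimage, measureReal_eq_sum_cell N]
  refine Finset.sum_congr rfl fun i _ => ?_
  rw [measureReal_eq_sum_inter_preimage_cell a N]
  refine Finset.sum_congr rfl fun j _ => ?_
  have hm {x} (hi : x ∈ cell N i) (hj : a.toEquiv x ∈ cell N j) :
      x ∈ symmDiff (cellUnion N 𝒜) (a.toEquiv ⁻¹' cellUnion N ℬ) ↔
        ¬ ((i : ℕ) ∈ 𝒜 ↔ (j : ℕ) ∈ ℬ) := by
    have hi' : ⌊(N : ℝ) * x⌋₊ = i := hi
    have hj' : ⌊(N : ℝ) * (a.toEquiv x : ℝ)⌋₊ = j := hj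
    rw [Set.mem_symmDiff, Set.mem_preimage, cellUnion, cellUnion, Set.mem_ofPred_eq,
      Set.mem_ofPred_eq, hi', hj']
    tauto
  rw [mismatch]
  split_ifs with h
  · rw [mul_zero, ← measureReal_empty (μ := (volume : Measure unitInterval))]
    congr 1
    exact Set.eq_empty_of_forall_notMem fun x hx => (hm hx.1.2 hx.2).1 hx.1.1 h
  · rw [mul_one]
    congr 1
    ext x
    exact ⟨fun hx => ⟨hx.1.2, hx.2⟩, fun hx => ⟨⟨(hm hx.1 hx.2).2 h, hx.1⟩, hx.2⟩⟩

/-- Row sums use that the preimages of cells partition [0,1] up to a null set; column sums use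
invariance of the measure. -/
theorem mem_doublyStochastic_cell (a : BorelAut) (N : ℕ) [NeZero N] :
    (Matrix.of fun i j : Fin N => (N : ℝ) * volume.real (cell N i ∩ a.toEquiv ⁻¹' cell N j)) ∈
      doublyStochastic ℝ (Fin N) := by
  have h0 : (N : ℝ) ≠ 0 := Nat.cast_ne_zero.2 (NeZero.ne N)
  rw [mem_doublyStochastic_iff_sum]
  refine ⟨fun i j => mul_nonneg (Nat.cast_nonneg _) measureReal_nonneg, fun i => ?_, fun j => ?_⟩
  · simp only [Matrix.of_apply]
    rw [← Finset.mul_sum, ← measureReal_eq_sum_inter_preimage_cell, measureReal_cell,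
      mul_inv_cancel₀ h0]
  · simp only [Matrix.of_apply, Set.inter_comm (cell N _)]
    rw [← Finset.mul_sum, ← measureReal_eq_sum_cell, measureReal_preimage, measureReal_cell,
      mul_inv_cancel₀ h0]

theorem imageDist_cellPerm (N : ℕ) [NeZero N] (e : Equiv.Perm (Fin N)) (𝒜 ℬ : Set ℕ) :
    imageDist (cellUnion N 𝒜) (cellUnion N ℬ) (cellPerm N e) =
      (N : ℝ)⁻¹ * ∑ i : Fin N, mismatch 𝒜 ℬ i (e i) := by
  rw [imageDist_cellUnion, Finset.mul_sum]
  refine Finset.sum_congr rfl fun i _ => ?_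
  have hcell {x : unitInterval} (hx : x ∈ cell N i) :
      ⌊(N : ℝ) * ((cellPerm N e).toEquiv x : ℝ)⌋₊ = e i := by
    rw [cellPerm_apply, floor_mul_cellMap, show ⌊(N : ℝ) * x⌋₊ = i from hx, extendNat_val]
  rw [Finset.sum_eq_single (e i)]
  · have h : cell N i ⊆ (cellPerm N e).toEquiv ⁻¹' cell N (e i) := fun x hx => hcell hx
    rw [Set.inter_eq_left.2 h, measureReal_cell]
  · intro j _ hj
    have h : cell N i ∩ (cellPerm N e).toEquiv ⁻¹' cell N j = ∅ := by
      refine Set.eq_empty_of_forall_notMem fun x hx => hj (Fin.ext ?_)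
      have hxj : ⌊(N : ℝ) * ((cellPerm N e).toEquiv x : ℝ)⌋₊ = j := hx.2
      exact hxj.symm.trans (hcell hx.1)
    rw [h, measureReal_empty, zero_mul]
  · simp

theorem cellUnion_mul (N n : ℕ) (𝒜 : Set ℕ) :
    cellUnion N 𝒜 = cellUnion (N * (n + 1)) {k | k / (n + 1) ∈ 𝒜} := by
  ext x
  have : (N : ℝ) * x = ((N * (n + 1) : ℕ) * x : ℝ) / (n + 1 : ℕ) := by
    push_cast
    field_simp
  simp only [cellUnion, Set.mem_ofPred_eq]
  rw [this, Nat.floor_div_natCast]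

theorem exists_pow_eq_one_imageDist_cellUnion_le (N : ℕ) [NeZero N] (σ : Equiv.Perm (Fin N))
    (n : ℕ) :
    ∃ h : BorelAut, h ^ (n + 1) = 1 ∧ ∀ 𝒜 ℬ,
      imageDist (cellUnion N 𝒜) (cellUnion N ℬ) h ≤
        (N : ℝ)⁻¹ * ∑ i : Fin N, mismatch 𝒜 ℬ i (σ i) + 1 / ((n : ℝ) + 1) := by
  have hN : (N : ℝ) ≠ 0 := Nat.cast_ne_zero.2 (NeZero.ne N)
  obtain ⟨e, he, heσ⟩ := σ.exists_pow_eq_one_fst_eq n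
  let φ : Equiv.Perm (Fin N × Fin (n + 1)) ≃* Equiv.Perm (Fin (N * (n + 1))) :=
    finProdFinEquiv.permCongrHom
  refine ⟨cellPerm (N * (n + 1)) (φ e), by rw [← map_pow, ← map_pow, he, map_one, map_one],
    fun 𝒜 ℬ => ?_⟩
  have hdiv (p : Fin N × Fin (n + 1)) : (finProdFinEquiv p : ℕ) / (n + 1) = p.1 := by
    rw [finProdFinEquiv_apply_val, Nat.add_mul_div_left _ _ n.succ_pos,
      Nat.div_eq_of_lt p.2.2, zero_add]
  -- Only the last copy can deviate from σ, at cost at most 1 for each i: N out of N (n + 1) small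
  -- cells.
  have hmis (i : Fin N) (t : Fin (n + 1)) :
      mismatch 𝒜 ℬ i (e (i, t)).1 ≤
        mismatch 𝒜 ℬ i (σ i) + if t = Fin.last n then 1 else 0 := by
    split_ifs with ht
    · linarith [mismatch_nonneg 𝒜 ℬ i (σ i), mismatch_le_one 𝒜 ℬ i (e (i, t)).1]
    · rw [heσ i t ht, add_zero]
  rw [cellUnion_mul N n 𝒜, cellUnion_mul N n ℬ, imageDist_cellPerm,
    ← finProdFinEquiv.sum_comp, Fintype.sum_prod_type]
  have hsum : ∑ i : Fin N, ∑ t : Fin (n + 1),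
      mismatch {k | k / (n + 1) ∈ 𝒜} {k | k / (n + 1) ∈ ℬ} (finProdFinEquiv (i, t))
        (φ e (finProdFinEquiv (i, t))) ≤
      (n + 1) * ∑ i : Fin N, mismatch 𝒜 ℬ i (σ i) + N := by
    calc _ = ∑ i : Fin N, ∑ t : Fin (n + 1), mismatch 𝒜 ℬ i (e (i, t)).1 := by
          refine Finset.sum_congr rfl fun i _ => Finset.sum_congr rfl fun t _ => ?_
          have : φ e (finProdFinEquiv (i, t)) = finProdFinEquiv (e (i, t)) := by
            simp [φ, Equiv.permCongrHom]
          rw [this, mismatch_setOf, hdiv, hdiv]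
      _ ≤ ∑ i : Fin N, ∑ t : Fin (n + 1),
          (mismatch 𝒜 ℬ i (σ i) + if t = Fin.last n then 1 else 0) :=
          Finset.sum_le_sum fun i _ => Finset.sum_le_sum fun t _ => hmis i t
      _ = _ := by
          simp [Finset.sum_add_distrib, Finset.mul_sum]
  calc _ ≤ ((N * (n + 1) : ℕ) : ℝ)⁻¹ * ((n + 1) * ∑ i : Fin N, mismatch 𝒜 ℬ i (σ i) + N) :=
        mul_le_mul_of_nonneg_left hsum (by positivity)
    _ = _ := by
        push_cast
        field_simp

theorem eventually_exists_pow_eq_one_imageDist_lt (g : BorelAut) (F : Finset (Set unitInterval))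
    (hF : ∀ A ∈ F, MeasurableSet A) {ε : ℝ} (hε : 0 < ε) :
    ∀ᶠ s in Filter.atTop, ∃ h : BorelAut, h ^ s = 1 ∧
      ∀ A ∈ F, imageDist A (g.toEquiv '' A) h < ε := by
  -- The errors 2δ for each A ∈ F, added up, and 2δ for returning from cell unions to A and gA make
  -- ε / 2; the other half absorbs 1 / (n + 1).
  set δ : ℝ := ε / (4 * (F.card + 1)) with hδdef
  have hδ : 0 < δ := by positivity
  have hδε : 2 * δ + F.card * (2 * δ) = ε / 2 := by
    rw [hδdef]
    field_simp
    ring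
  have hev : ∀ᶠ N : ℕ in Filter.atTop, ∀ A ∈ F,
      (∃ 𝒜, volume.real (symmDiff A (cellUnion N 𝒜)) < δ) ∧
        ∃ ℬ, volume.real (symmDiff (g.toEquiv '' A) (cellUnion N ℬ)) < δ :=
    (Finset.eventually_all F).2 fun A hA => (eventually_exists_cellUnion (hF A hA) hδ).and
      (eventually_exists_cellUnion (g.measurableSet_image (hF A hA)) hδ)
  obtain ⟨N, hN, hN0⟩ := (hev.and (Filter.eventually_ne_atTop 0)).exists
  have : NeZero N := ⟨hN0⟩
  have hN' : (N : ℝ) ≠ 0 := Nat.cast_ne_zero.2 hN0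
  choose! 𝒜 h𝒜 using fun A hA => (hN A hA).1
  choose! ℬ hℬ using fun A hA => (hN A hA).2
  have hgAB (A) (hA : A ∈ F) :
      imageDist (cellUnion N (𝒜 A)) (cellUnion N (ℬ A)) g ≤ 2 * δ := by
    have h1 := imageDist_mul_le g 1 (cellUnion N (𝒜 A)) A (cellUnion N (ℬ A))
    rw [mul_one, imageDist_one, symmDiff_comm] at h1
    have h2 : imageDist A (cellUnion N (ℬ A)) g < δ := hℬ A hA
    linarith [h𝒜 A hA]
  -- One permutation must serve all A ∈ F, so the summed cost is minimised; its terms are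
  -- nonnegative, so it bounds each of them.
  obtain ⟨σ, hσ⟩ := exists_perm_sum_le (mem_doublyStochastic_cell g N)
    fun i j => ∑ A ∈ F, mismatch (𝒜 A) (ℬ A) i j
  have hσ' : (N : ℝ)⁻¹ * ∑ A ∈ F, ∑ i : Fin N, mismatch (𝒜 A) (ℬ A) i (σ i) ≤
      F.card * (2 * δ) := by
    have h1 : ∑ i : Fin N, ∑ j : Fin N,
        (N : ℝ) * volume.real (cell N i ∩ g.toEquiv ⁻¹' cell N j) *
          ∑ A ∈ F, mismatch (𝒜 A) (ℬ A) i j =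
        N * ∑ A ∈ F, imageDist (cellUnion N (𝒜 A)) (cellUnion N (ℬ A)) g := by
      simp only [imageDist_cellUnion, Finset.mul_sum, mul_assoc]
      rw [Finset.sum_comm (s := F)]
      refine Finset.sum_congr rfl fun i _ => ?_
      rw [Finset.sum_comm (s := F)]
    have h2 : ∑ A ∈ F, imageDist (cellUnion N (𝒜 A)) (cellUnion N (ℬ A)) g ≤
        F.card * (2 * δ) := by
      simpa using Finset.sum_le_card_nsmul F _ _ hgAB
    simp only [Matrix.of_apply] at hσ
    rw [h1, Finset.sum_comm] at hσ
    rw [inv_mul_le_iff₀ (by positivity)]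
    exact hσ.trans (mul_le_mul_of_nonneg_left h2 (by positivity))
  obtain ⟨s₀, hs₀⟩ := exists_nat_one_div_lt (half_pos hε)
  filter_upwards [Filter.eventually_ge_atTop (s₀ + 1)] with s hs
  obtain ⟨n, rfl⟩ : ∃ n, s = n + 1 := ⟨s - 1, by omega⟩
  obtain ⟨h, hpow, hh⟩ := exists_pow_eq_one_imageDist_cellUnion_le N σ n
  refine ⟨h, hpow, fun A hA => ?_⟩
  have hn : 1 / ((n : ℝ) + 1) < ε / 2 := by
    refine lt_of_le_of_lt ?_ hs₀
    have : (s₀ : ℝ) ≤ n := by exact_mod_cast Nat.le_of_succ_le_succ hs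
    gcongr
  have h1 : (N : ℝ)⁻¹ * ∑ i : Fin N, mismatch (𝒜 A) (ℬ A) i (σ i) ≤ F.card * (2 * δ) := by
    refine le_trans (mul_le_mul_of_nonneg_left ?_ (by positivity)) hσ'
    exact Finset.single_le_sum (f := fun A => ∑ i : Fin N, mismatch (𝒜 A) (ℬ A) i (σ i))
      (fun A _ => Finset.sum_nonneg fun i _ => mismatch_nonneg _ _ _ _) hA
  have h2 := hh (𝒜 A) (ℬ A)
  have h3 := imageDist_mul_le h 1 A (cellUnion N (𝒜 A)) (g.toEquiv '' A)
  have h4 := imageDist_mul_le 1 h (cellUnion N (𝒜 A)) (cellUnion N (ℬ A)) (g.toEquiv '' A)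
  rw [mul_one, imageDist_one] at h3
  rw [one_mul, imageDist_one, symmDiff_comm] at h4
  linarith [h𝒜 A hA, hℬ A hA]

end BorelAut

/-! ### Density of periodic automorphisms, and the conclusion. -/

namespace AutLebesgue

/-- Periodic automorphisms with periods in a given unbounded set are dense. -/
theorem dense_setOf_exists_pow_eq_one (S : Set ℕ) (hS : ∀ n, ∃ s ∈ S, n ≤ s) :
    Dense {g : AutLebesgue | ∃ s ∈ S, g ^ s = 1} := by
  classical
  intro g
  obtain ⟨a, rfl⟩ := mk_surjective g
  -- A net indexed by finite families of Borel sets and precisions: no countable base is needed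
  -- here.
  have key (p : Finset {A : Set unitInterval // MeasurableSet A} × ℕ) :
      ∃ h : BorelAut, (∃ s ∈ S, h ^ s = 1) ∧
        ∀ A ∈ p.1, BorelAut.imageDist A (a.toEquiv '' A) h < 1 / ((p.2 : ℝ) + 1) := by
    have h1 := a.eventually_exists_pow_eq_one_imageDist_lt (p.1.image Subtype.val)
      (fun A hA => by
        obtain ⟨B, -, rfl⟩ := Finset.mem_image.1 hA
        exact B.2) (Nat.one_div_pos_of_nat (α := ℝ) (n := p.2))
    obtain ⟨s₀, hs₀⟩ := Filter.eventually_atTop.1 h1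
    obtain ⟨s, hs, hss⟩ := hS s₀
    obtain ⟨h, hh, hA⟩ := hs₀ s hss
    exact ⟨h, ⟨s, hs, hh⟩, fun A hAp => hA _ (Finset.mem_image_of_mem _ hAp)⟩
  choose h hpow hdist using key
  refine mem_closure_of_tendsto (f := fun p => mk (h p)) (b := Filter.atTop) ?_
    (.of_forall fun p => ?_)
  · refine tendsto_nhds_of_imageDist fun A B hA hB h0 => ?_
    have ht : Filter.Tendsto
        (fun p : Finset {A : Set unitInterval // MeasurableSet A} × ℕ => 1 / ((p.2 : ℝ) + 1))
        Filter.atTop (𝓝 0) := by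
      rw [← Filter.prod_atTop_atTop_eq]
      exact (tendsto_one_div_add_atTop_nhds_zero_nat (𝕜 := ℝ)).comp Filter.tendsto_snd
    refine squeeze_zero' (.of_forall fun _ => imageDist_nonneg _ _ _) ?_ ht
    filter_upwards [Filter.eventually_ge_atTop
      (({⟨A, hA⟩} : Finset {A : Set unitInterval // MeasurableSet A}), 0)] with p hp
    have h1 := hdist p ⟨A, hA⟩ (hp.1 (Finset.mem_singleton_self _))
    have h2 := BorelAut.imageDist_mul_le 1 (h p) A (a.toEquiv '' A) B
    rw [one_mul, BorelAut.imageDist_one] at h2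
    have h3 : volume.real (symmDiff (a.toEquiv '' A) B) = 0 := h0
    rw [imageDist_mk]
    linarith
  · obtain ⟨s, hs, hps⟩ := hpow p
    exact ⟨s, hs, by rw [← map_pow, hps, map_one]⟩

end AutLebesgue

theorem corollary6p2 (f : AutLebesgue) :
    IsMeagre {g : AutLebesgue | TopologicallySimilar f g} ∧
      {g : AutLebesgue | IsConj f g} ⊆ {g : AutLebesgue | TopologicallySimilar f g} ∧
      IsMeagre {g : AutLebesgue | IsConj f g} := by
  have h1 : IsMeagre {g : AutLebesgue | TopologicallySimilar f g} :=
    isMeagre_setOf_topologicallySimilar AutLebesgue.dense_setOf_exists_pow_eq_one f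
  have h2 : {g : AutLebesgue | IsConj f g} ⊆ {g : AutLebesgue | TopologicallySimilar f g} :=
    fun _ hg => TopologicallySimilar.of_isConj hg
  exact ⟨h1, h2, h1.mono h2⟩
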